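/- Let $G$ be a finite simple planar graph, i.e. a finite simple graph that can be drawn in the plane with distinct points as vertices and simple arcs as edges, each arc joining the two ends of its edge and containing no other vertex, so that two distinct arcs meet at most in common ends. Let $g\ge 3$ be an integer, and suppose that $G$ has girth at least $g$, i.e. every cycle of $G$ has length at least $g$ (a forest has infinite girth). Then $$\mathrm{mad}(G)<\frac{2g}{g-2},$$ where $\mathrm{mad}(G)=\max_{H\subseteq G,\ |V(H)|\ge 1}\frac{2|E(H)|}{|V(H)|}$ is the maximum average degree of $G$ (taken to be $0$ if $G$ has no vertices). -/

import Mathlib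

/-- The Euclidean plane. -/
abbrev Plane : Type := EuclideanSpace ℝ (Fin 2)

/-- `A` is a (simple, continuous) arc in the plane joining `p` to `q`: the image of an injective
path from `p` to `q`. -/
def IsArcBetween (p q : Plane) (A : Set Plane) : Prop :=
  ∃ γ : Path p q, Function.Injective γ ∧ Set.range γ = A

/-- A drawing of a simple graph in the plane without crossings: distinct vertices are distinct
points, every edge is an arc joining its two ends, an edge contains no vertices other than its
two ends, and any two distinct edges meet only in vertices. -/
structure PlaneDrawing {V : Type*} (G : SimpleGraph V) where
  /-- the position of a vertex -/
  point : V → Plane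
  /-- the arc that represents an edge (only the values on edges of `G` matter) -/
  arc : Sym2 V → Set Plane
  point_injective : Function.Injective point
  isArcBetween : ∀ u v : V, G.Adj u v → IsArcBetween (point u) (point v) (arc s(u, v))
  mem_of_point_mem : ∀ e ∈ G.edgeSet, ∀ w : V, point w ∈ arc e → w ∈ e
  inter_subset : ∀ e ∈ G.edgeSet, ∀ f ∈ G.edgeSet, e ≠ f → arc e ∩ arc f ⊆ Set.range point

/-- A graph is planar if it can be drawn in the plane without crossings. -/
def IsPlanar {V : Type*} (G : SimpleGraph V) : Prop := Nonempty (PlaneDrawing G)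

/-- The average degrees `2|E(H)| / |V(H)|` of the subgraphs `H` of `G` with at least one vertex. -/
def subgraphAverageDegrees {V : Type*} (G : SimpleGraph V) : Set ℝ :=
  {x | ∃ H : G.Subgraph, 1 ≤ H.verts.ncard ∧
    x = 2 * (H.edgeSet.ncard : ℝ) / (H.verts.ncard : ℝ)}

/-- The maximum average degree of a finite graph. For a finite graph with at least one vertex the
supremum is a maximum, see `mad_isGreatest`; the graph without vertices gets the value `0`. -/
noncomputable def mad {V : Type*} (G : SimpleGraph V) : ℝ := sSup (subgraphAverageDegrees G)

theorem mad_isGreatest {V : Type*} [Finite V] [Nonempty V] (G : SimpleGraph V) :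
    IsGreatest (subgraphAverageDegrees G) (mad G) := by
  have hfin : (subgraphAverageDegrees G).Finite := by
    refine (Set.finite_range (fun H : G.Subgraph =>
      2 * (H.edgeSet.ncard : ℝ) / (H.verts.ncard : ℝ))).subset ?_
    rintro x ⟨H, -, rfl⟩
    exact ⟨H, rfl⟩
  have hne : (subgraphAverageDegrees G).Nonempty := by
    refine ⟨_, ⊤, ?_, rfl⟩
    rw [SimpleGraph.Subgraph.verts_top, Set.ncard_univ]
    exact Nat.card_pos
  exact ⟨hne.csSup_mem hfin, fun x hx => le_csSup hfin.bddAbove hx⟩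

/-!
Let `n` and `m` be the numbers of vertices and edges. The cycle space over `ZMod 2` has dimension at
least `m - n + 1`. A point `x` off the drawing determines a linear functional on the cycle space,
which records for each even edge set `C` on which side of `C` the point lies; the functionals that
arise next to the edges play the role of the faces.

The Jordan curve theorem is not needed to define these functionals. Off an arc from `p` to `q` the
function `(p - x) * (q - x)` has a continuous square root. The product of these roots over the edges
of `C` has the same square as a polynomial, because `C` is even at every vertex, so it agrees with
that polynomial up to a sign that is constant on every connected set that avoids `C`. If the arc is
straight near its end `p`, its square root changes sign on one turn around `p`. Hence the
functionals on the two sides of the edge `e` differ by the coordinate `C e`.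

Consequently the faces span the dual of the cycle space. Every edge has at most two faces at its
sides. The edges of one face have no leaf, because one turn around a vertex leads back to the same
functional, so they contain a cycle and there are at least `g` of them. Double counting gives
`g * (m - n + 1) ≤ 2 * m`, and this inequality for all subgraphs is the bound on the maximum average
degree.
-/

section Combinatorics

open Module

open scoped Classical in
/-- The boundary map of a finite graph over `ZMod 2`: it sends a weight on the edges to its sums
around the vertices. -/
noncomputable def edgeBoundary {V : Type*} [Fintype V] (G : SimpleGraph V) :
    (G.edgeSet → ZMod 2) →ₗ[ZMod 2] V → ZMod 2 :=
  LinearMap.pi fun v => ∑ e with v ∈ e.1, LinearMap.proj e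

/-- The cycle space of a finite graph over `ZMod 2`, whose elements are the (indicators of) edge
sets that meet every vertex an even number of times. -/
noncomputable def cycleSpace {V : Type*} [Fintype V] (G : SimpleGraph V) :
    Submodule (ZMod 2) (G.edgeSet → ZMod 2) :=
  LinearMap.ker (edgeBoundary G)

variable {V : Type*} {G : SimpleGraph V}

open scoped Classical in
@[to_additive]
theorem prod_ends {M : Type*} [CommMonoid M] [Fintype V] {e : G.edgeSet} {u v : V}
    (he : e.1 = s(u, v)) (f : V → M) : ∏ w with w ∈ e.1, f w = f u * f v := by
  have huv : u ≠ v := G.ne_of_adj (G.mem_edgeSet.1 (he ▸ e.2))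
  rw [he, show ({w | w ∈ s(u, v)} : Finset V) = {u, v} by ext; simp, Finset.prod_pair huv]

open scoped Classical in
theorem mem_cycleSpace [Fintype V] {C : G.edgeSet → ZMod 2} :
    C ∈ cycleSpace G ↔ ∀ v, ∑ e with v ∈ e.1, C e = 0 := by
  simp [cycleSpace, edgeBoundary, funext_iff]

variable (G) in
open scoped Classical in
theorem card_edgeSet_add_one_le_card_add_finrank_cycleSpace [Fintype V] [Nonempty V] :
    Fintype.card G.edgeSet + 1 ≤ Fintype.card V + finrank (ZMod 2) (cycleSpace G) := by
  let total : (V → ZMod 2) →ₗ[ZMod 2] ZMod 2 := ∑ v, LinearMap.proj v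
  have total_surjective : Function.Surjective total := fun a =>
    ⟨Pi.single (Classical.arbitrary V) a, by simp [total]⟩
  have range_le_ker : LinearMap.range (edgeBoundary G) ≤ LinearMap.ker total := by
    rintro _ ⟨C, rfl⟩
    have even_ends (e : G.edgeSet) : ∑ v with v ∈ e.1, C e = 0 := by
      obtain ⟨⟨u, v⟩, he⟩ := Sym2.mk_surjective e.1
      rw [sum_ends he.symm fun _ => C e, CharTwo.add_self_eq_zero]
    simp only [LinearMap.mem_ker, total, edgeBoundary, LinearMap.sum_apply, LinearMap.proj_apply,
      LinearMap.pi_apply]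
    rw [Finset.sum_comm' (t' := .univ) (s' := fun e => {v | v ∈ e.1}) (by simp)]
    exact Finset.sum_eq_zero fun e _ => even_ends e
  have rank_boundary := (edgeBoundary G).finrank_range_add_finrank_ker
  have rank_total := total.finrank_range_add_finrank_ker
  have rank_le := Submodule.finrank_mono range_le_ker
  rw [LinearMap.range_eq_top.2 total_surjective, finrank_top] at rank_total
  simp only [finrank_fintype_fun_eq_card, finrank_self] at rank_boundary rank_total
  rw [cycleSpace]
  omega

theorem not_isAcyclic_of_forall_adj_exists_adj_ne [Finite G.edgeSet]
    (leafless : ∀ u v, G.Adj u v → ∃ w, G.Adj u w ∧ w ≠ v) (hG : G ≠ ⊥) : ¬ G.IsAcyclic := by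
  intro acyclic
  obtain ⟨a, b, hab⟩ := SimpleGraph.ne_bot_iff_exists_adj.1 hG
  have : Nonempty V := ⟨a⟩
  obtain ⟨u, v, p, hp, longest⟩ := SimpleGraph.Walk.exists_isPath_forall_isPath_length_le_length G
  cases p with
  | nil =>
    have := longest a b hab.toWalk (by simp [SimpleGraph.Adj.toWalk, hab.ne])
    simp [SimpleGraph.Adj.toWalk] at this
  | @cons _ x _ hux q =>
    obtain ⟨w, huw, hwx⟩ := leafless u x hux
    by_cases hw : w ∈ (SimpleGraph.Walk.cons hux q).support
    · exact hwx (by simpa using acyclic.eq_snd_of_adj_start hp huw hw)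
    · have := longest w v _ (hp.cons (h := huw.symm) hw)
      simp at this

theorem egirth_le_card_edgeSet [Fintype G.edgeSet] (hG : ¬ G.IsAcyclic) :
    G.egirth ≤ Fintype.card G.edgeSet := by
  classical
  obtain ⟨v, w, hw, hgirth⟩ := SimpleGraph.exists_egirth_eq_length.2 hG
  rw [hgirth, ← SimpleGraph.edgeFinset_card]
  exact_mod_cast hw.isTrail.length_le_card_edgeFinset

theorem egirth_le_card_of_leafless {s : Finset G.edgeSet} (hs : s.Nonempty)
    (leafless : ∀ e ∈ s, ∀ v ∈ e.1, ∃ f ∈ s, f ≠ e ∧ v ∈ f.1) : G.egirth ≤ s.card := by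
  classical
  let H := SimpleGraph.fromEdgeSet (Subtype.val '' (s : Set G.edgeSet))
  have edgeSet_H : H.edgeSet = Subtype.val '' (s : Set G.edgeSet) := by
    rw [SimpleGraph.edgeSet_fromEdgeSet, sdiff_eq_left, Set.disjoint_left]
    rintro _ ⟨e, -, rfl⟩
    exact G.not_isDiag_of_mem_edgeSet e.2
  have le_G : H ≤ G := by
    rw [← SimpleGraph.edgeSet_subset_edgeSet, edgeSet_H]
    exact Subtype.coe_image_subset _ _
  have ne_bot : H ≠ ⊥ := by
    rw [← SimpleGraph.edgeSet_nonempty, edgeSet_H]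
    exact hs.to_set.image _
  have : Finite H.edgeSet := by
    rw [edgeSet_H]
    exact (s.finite_toSet.image _).to_subtype
  have : Fintype H.edgeSet := .ofFinite _
  have leafless_H : ∀ u v, H.Adj u v → ∃ w, H.Adj u w ∧ w ≠ v := by
    simp only [← SimpleGraph.mem_edgeSet, edgeSet_H]
    rintro u v ⟨e, he, huv⟩
    obtain ⟨f, hf, hfe, huf⟩ := leafless e he u (by simp [huv])
    obtain ⟨w, hw⟩ := Sym2.mem_iff_exists.1 huf
    exact ⟨w, ⟨f, hf, hw⟩, by rintro rfl; exact hfe (Subtype.ext (hw.trans huv.symm))⟩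
  calc G.egirth ≤ H.egirth := SimpleGraph.egirth_anti le_G
    _ ≤ Fintype.card H.edgeSet :=
      egirth_le_card_edgeSet (not_isAcyclic_of_forall_adj_exists_adj_ne leafless_H ne_bot)
    _ = s.card := by
      rw [← Nat.card_eq_fintype_card, Nat.card_coe_set_eq, edgeSet_H,
        Set.ncard_image_of_injective _ Subtype.val_injective, Set.ncard_coe_finset]

theorem mul_finrank_le_of_sides {K : Type*} [Field K]
    {W : Submodule K (G.edgeSet → K)} [Fintype G.edgeSet] {g : ℕ} (hg : (g : ℕ∞) ≤ G.egirth)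
    (sides : G.edgeSet → Finset (Dual K W)) (card_sides : ∀ e, (sides e).card ≤ 2)
    (sum_sides : ∀ e C, ∑ φ ∈ sides e, φ C = C.1 e)
    (leafless : ∀ e, ∀ φ ∈ sides e, ∀ v ∈ e.1, ∃ f, f ≠ e ∧ v ∈ f.1 ∧ φ ∈ sides f) :
    g * finrank K W ≤ 2 * Fintype.card G.edgeSet := by
  classical
  let faces := Finset.univ.biUnion sides
  have finrank_le : finrank K W ≤ faces.card := by
    let eval : W →ₗ[K] faces → K := LinearMap.pi fun φ => φ.1
    have eval_injective : Function.Injective eval := by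
      refine LinearMap.ker_eq_bot.1 (LinearMap.ker_eq_bot'.2 fun C hC => ?_)
      ext e
      rw [← sum_sides e C]
      refine Finset.sum_eq_zero fun φ hφ => ?_
      exact congrFun hC ⟨φ, Finset.mem_biUnion.2 ⟨e, Finset.mem_univ e, hφ⟩⟩
    simpa using LinearMap.finrank_le_finrank_of_injective eval_injective
  have le_boundary : ∀ φ ∈ faces, g ≤ (Finset.univ.filter fun e => φ ∈ sides e).card := by
    intro φ hφ
    obtain ⟨e, -, he⟩ := Finset.mem_biUnion.1 hφ
    refine Nat.cast_le.1 (hg.trans (egirth_le_card_of_leafless ⟨e, by simpa using he⟩ ?_))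
    intro e he v hv
    obtain ⟨f, hfe, hvf, hf⟩ := leafless e φ (Finset.mem_filter.1 he).2 v hv
    exact ⟨f, by simpa using hf, hfe, hvf⟩
  calc g * finrank K W ≤ faces.card * g := by rw [mul_comm]; gcongr
    _ ≤ ∑ φ ∈ faces, (Finset.univ.filter fun e => φ ∈ sides e).card := by
      simpa using Finset.card_nsmul_le_sum _ _ _ le_boundary
    _ = ∑ e, (faces.filter fun φ => φ ∈ sides e).card :=
      Finset.sum_card_bipartiteAbove_eq_sum_card_bipartiteBelow _
    _ ≤ ∑ e : G.edgeSet, 2 := Finset.sum_le_sum fun e _ =>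
      (Finset.card_le_card fun φ hφ => (Finset.mem_filter.1 hφ).2).trans (card_sides e)
    _ = 2 * Fintype.card G.edgeSet := by simp [mul_comm]

end Combinatorics

section OneSidedLimits

open Filter Topology Set

theorem eventually_circleMap_ne (c w : ℂ) {R : ℝ} (hR : R ≠ 0) (θ : ℝ) :
    ∀ᶠ t in 𝓝[≠] θ, circleMap c R t ≠ w :=
  (hasDerivAt_circleMap c R θ).eventually_ne (by simp [hR, Complex.I_ne_zero])

variable {X : Type*} {f l r : ℝ → X}

theorem eq_of_periodic_of_circleMap_eq (hf : f.Periodic (2 * Real.pi)) {c : ℂ} {R : ℝ} (hR : R ≠ 0)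
    {s t : ℝ} (h : circleMap c R s = circleMap c R t) : f s = f t := by
  obtain ⟨n, hn⟩ := (circleMap_eq_circleMap_iff c hR).1 h
  have s_eq : s = t + n * (2 * Real.pi) := by
    rw [← mul_assoc, ← add_mul] at hn
    exact_mod_cast mul_right_cancel₀ Complex.I_ne_zero hn
  rw [s_eq, hf.int_mul n t]

theorem eventually_leftValue_eq (left_value : ∀ θ, ∀ᶠ t in 𝓝[<] θ, f t = l θ) {θ : ℝ} {x : X}
    {s : Set ℝ} (hs : IsOpen s) (hx : ∀ᶠ t in 𝓝[s] θ, f t = x) : ∀ᶠ t in 𝓝[s] θ, l t = x := by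
  filter_upwards [eventually_eventually_nhdsWithin.2 hx, self_mem_nhdsWithin] with t ht hts
  rw [hs.nhdsWithin_eq hts] at ht
  obtain ⟨y, hl, hx⟩ := ((left_value t).and (ht.filter_mono nhdsWithin_le_nhds)).exists
  exact hl.symm.trans hx

theorem tendsto_add_const_nhdsLT (T θ : ℝ) : Tendsto (· + T) (𝓝[<] θ) (𝓝[<] (θ + T)) :=
  (continuous_add_const T).continuousWithinAt.tendsto_nhdsWithin fun t ht => by simpa using ht

theorem tendsto_add_const_nhdsGT (T θ : ℝ) : Tendsto (· + T) (𝓝[>] θ) (𝓝[>] (θ + T)) :=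
  (continuous_add_const T).continuousWithinAt.tendsto_nhdsWithin fun t ht => by simpa using ht

theorem periodic_of_eventually_eq {F : ℝ → Filter ℝ} [∀ θ, (F θ).NeBot] {T : ℝ}
    (shift : ∀ θ, Tendsto (· + T) (F θ) (F (θ + T))) (value : ∀ θ, ∀ᶠ t in F θ, f t = l θ)
    (hf : f.Periodic T) : l.Periodic T := by
  intro θ
  obtain ⟨t, ht, ht'⟩ := ((value θ).and ((shift θ).eventually (value (θ + T)))).exists
  rw [← ht, ← ht', hf t]

theorem leftValue_eq_rightValue_of_periodic
    (left_value : ∀ θ, ∀ᶠ t in 𝓝[<] θ, f t = l θ) (right_value : ∀ θ, ∀ᶠ t in 𝓝[>] θ, f t = r θ)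
    {T : ℝ} (hT : 0 < T) (hf : f.Periodic T) {a : ℝ} (no_jump : ∀ θ ∈ Ioo a (a + T), l θ = r θ) :
    l a = r a := by
  have l_left θ := eventually_leftValue_eq left_value isOpen_Iio (left_value θ)
  have l_right θ := eventually_leftValue_eq left_value isOpen_Ioi (right_value θ)
  have l_locally_constant : ∀ θ ∈ Ioo a (a + T), ∀ᶠ t in 𝓝 θ, l t = l θ := by
    intro θ hθ
    rw [← nhdsNE_sup_pure, ← Iio_union_Ioi, nhdsWithin_union]
    simp only [eventually_sup, l_left θ, true_and, eventually_pure, and_true]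
    exact no_jump θ hθ ▸ l_right θ
  have periodic_l : l (a + T) = l a :=
    periodic_of_eventually_eq (tendsto_add_const_nhdsLT T) left_value hf a
  obtain ⟨t, ht, hta⟩ := ((l_right a).and (Ioo_mem_nhdsGT (lt_add_of_pos_right a hT))).exists
  obtain ⟨s, hs, hsa⟩ := ((l_left (a + T)).and (Ioo_mem_nhdsLT (lt_add_of_pos_right a hT))).exists
  have l_constant : l s = l t := by
    let : TopologicalSpace X := ⊥
    have : DiscreteTopology X := ⟨rfl⟩
    refine isPreconnected_Ioo.constant (fun θ hθ => ContinuousAt.continuousWithinAt ?_) hsa hta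
    simpa [ContinuousAt] using l_locally_constant θ hθ
  rw [← periodic_l, ← hs, l_constant, ht]

end OneSidedLimits

section SquareRoots

open Set Complex

theorem exists_continuous_exp_eq_of_homotopy_one {A : Type*} [TopologicalSpace A]
    (H : C(unitInterval × A, ℂ)) (H_ne_zero : ∀ x, H x ≠ 0) (H_zero : ∀ a, H (0, a) = 1) :
    ∃ f : C(A, ℂ), ∀ a, exp (f a) = H (1, a) := by
  let H' : C(unitInterval × A, {z : ℂ // z ≠ 0}) := ⟨fun x => ⟨H x, H_ne_zero x⟩, by fun_prop⟩
  have lift_zero (a : A) : H' (0, a) = ⟨exp (ContinuousMap.const A 0 a), exp_ne_zero _⟩ := by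
    simp [H', H_zero]
  let F := isCoveringMap_exp.liftHomotopy H' (.const A 0) lift_zero
  exact ⟨F.comp (.prodMk (.const A 1) (.id A)), fun a => congrArg Subtype.val
    (congrFun (isCoveringMap_exp.liftHomotopy_lifts H' (.const A 0) lift_zero) (1, a))⟩

theorem exists_continuousOn_compl_range_sq_eq {p q : ℂ} (γ : Path p q) :
    ∃ h : ℂ → ℂ, ContinuousOn h (range γ)ᶜ ∧
      ∀ x ∉ range γ, h x ^ 2 = (p - x) * (q - x) := by
  -- Letting the end of `γ` move from `p` to `q` gives a logarithm of `(q - x) / (p - x)`.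
  have sub_ne_zero (t : unitInterval) (x : ↥(range γ)ᶜ) : γ t - x ≠ 0 :=
    sub_ne_zero.2 fun h => x.2 ⟨t, h⟩
  have p_sub_ne_zero (x : ↥(range γ)ᶜ) : p - x ≠ 0 := by simpa using sub_ne_zero 0 x
  obtain ⟨log, exp_log⟩ := exists_continuous_exp_eq_of_homotopy_one
    ⟨fun y : unitInterval × ↥(range γ)ᶜ => (γ y.1 - y.2) / (p - y.2),
      Continuous.div (by fun_prop) (by fun_prop) fun y => p_sub_ne_zero y.2⟩
    (fun y => div_ne_zero (sub_ne_zero _ _) (p_sub_ne_zero _))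
    (fun x => by simp [div_self (p_sub_ne_zero x)])
  simp only [ContinuousMap.coe_mk, γ.target] at exp_log
  let h (x : ↥(range γ)ᶜ) : ℂ := (p - x) * exp (log x / 2)
  have h_sq (x) : h x ^ 2 = (p - x) * (q - x) := by
    have := p_sub_ne_zero x
    rw [mul_pow, ← exp_nat_mul, Nat.cast_two, mul_div_cancel₀ _ two_ne_zero, exp_log]
    field_simp
  classical
  refine ⟨fun x => if hx : x ∈ (range γ)ᶜ then h ⟨x, hx⟩ else 0, ?_, fun x hx => ?_⟩
  · rw [continuousOn_iff_continuous_domRestrict, domRestrict_dite]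
    exact (by fun_prop : Continuous h)
  · simp only [dif_pos (mem_compl hx), h_sq]

theorem exists_continuous_antiperiodic_sq_eq {c q : ℂ} {R : ℝ} (hR : |R| < dist q c) :
    ∃ k : ℝ → ℂ, Continuous k ∧ k.Antiperiodic (2 * Real.pi) ∧
      ∀ t, k t ^ 2 = (c - circleMap c R t) * (q - circleMap c R t) := by
  have hq : q - c ≠ 0 := by
    rw [dist_eq] at hR
    exact norm_pos_iff.1 ((abs_nonneg R).trans_lt hR)
  let w (t : ℝ) : ℂ := 1 - circleMap 0 R t / (q - c)
  have w_continuous : Continuous w := by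
    have := continuous_circleMap 0 R
    fun_prop (disch := assumption)
  have w_mem_slitPlane (t : ℝ) : w t ∈ slitPlane := by
    rw [dist_eq] at hR
    simp only [w, sub_eq_add_neg (1 : ℂ)]
    refine mem_slitPlane_of_norm_lt_one ?_
    rwa [norm_neg, norm_div, norm_circleMap_zero, div_lt_one (norm_pos_iff.2 hq)]
  refine ⟨fun t => (-(R * (q - c))) ^ (2⁻¹ : ℂ) * exp (t * I / 2) * w t ^ (2⁻¹ : ℂ), ?_, ?_, ?_⟩
  · exact (by fun_prop : Continuous fun t : ℝ => _ * exp (t * I / 2)).mul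
      (w_continuous.cpow continuous_const w_mem_slitPlane)
  · intro t
    have half_turn : exp (((t + 2 * Real.pi : ℝ) : ℂ) * I / 2) = -exp (t * I / 2) := by
      rw [← exp_add_pi_mul_I]
      push_cast
      ring_nf
    simp only [w, periodic_circleMap 0 R t, half_turn]
    ring
  · intro t
    have exp_sq : exp (t * I / 2) ^ 2 = exp (t * I) := by
      rw [← exp_nat_mul]
      push_cast
      ring_nf
    rw [mul_pow, mul_pow, cpow_ofNat_inv_pow, cpow_ofNat_inv_pow, exp_sq]
    simp only [w, circleMap]
    field_simp
    ring

theorem exists_continuous_eq_and_eq_neg_of_sq_eq {c q : ℂ} {R θ : ℝ} (hR₀ : R ≠ 0)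
    (hR : |R| < dist q c) {h : ℂ → ℂ}
    (h_continuous : ContinuousOn h (circleMap c R '' Ioo θ (θ + 2 * Real.pi)))
    (h_sq : ∀ x ∈ circleMap c R '' Ioo θ (θ + 2 * Real.pi), h x ^ 2 = (c - x) * (q - x)) :
    ∃ k : ℝ → ℂ, Continuous k ∧
      (∀ t ∈ Ioo θ (θ + 2 * Real.pi), h (circleMap c R t) = k t) ∧
      ∀ t ∈ Ioo (θ - 2 * Real.pi) θ, h (circleMap c R t) = -k t := by
  suffices ∃ k : ℝ → ℂ, Continuous k ∧ k.Antiperiodic (2 * Real.pi) ∧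
      ∀ t ∈ Ioo θ (θ + 2 * Real.pi), h (circleMap c R t) = k t by
    obtain ⟨k, k_continuous, k_antiperiodic, hk⟩ := this
    refine ⟨k, k_continuous, hk, fun t ht => ?_⟩
    rw [← periodic_circleMap, ← k_antiperiodic]
    exact hk _ ⟨by linarith [ht.1], by linarith [ht.2]⟩
  obtain ⟨k, k_continuous, k_antiperiodic, k_sq⟩ := exists_continuous_antiperiodic_sq_eq hR
  have k_ne_zero (t : ℝ) : k t ≠ 0 := by
    refine pow_ne_zero_iff two_ne_zero |>.1 (k_sq t ▸ mul_ne_zero ?_ ?_)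
    · exact sub_ne_zero.2 (circleMap_ne_center hR₀).symm
    · refine sub_ne_zero.2 fun hq => hR.ne ?_
      simp [hq, dist_eq]
  rcases isPreconnected_Ioo.eq_or_eq_neg_of_sq_eq
      (h_continuous.comp (continuous_circleMap c R).continuousOn (mapsTo_image _ _))
      k_continuous.continuousOn
      (fun t ht => (h_sq _ (mem_image_of_mem _ ht)).trans (k_sq t).symm) (fun _ => k_ne_zero _)
      with hk | hk
  · exact ⟨k, k_continuous, k_antiperiodic, hk⟩
  · exact ⟨-k, k_continuous.neg, fun t => congrArg Neg.neg (k_antiperiodic t), hk⟩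

end SquareRoots

section Drawings

open Filter Topology Set Metric

variable {V : Type*} {G : SimpleGraph V}

theorem PlaneDrawing.isClosed_arc (D : PlaneDrawing G) (e : G.edgeSet) : IsClosed (D.arc e) := by
  obtain ⟨e, he⟩ := e
  induction e with | _ u v
  obtain ⟨γ, -, hγ⟩ := D.isArcBetween u v he
  exact hγ ▸ (isCompact_range γ.continuous).isClosed

theorem PlaneDrawing.eventually_disjoint_arc_closedBall (D : PlaneDrawing G) {e : G.edgeSet} {v : V}
    (hv : v ∉ e.1) : ∀ᶠ ρ in 𝓝[>] 0, Disjoint (D.arc e) (closedBall (D.point v) ρ) := by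
  obtain ⟨ε, hε, h⟩ := isOpen_iff.1 (D.isClosed_arc e).isOpen_compl (D.point v)
    fun h => hv (D.mem_of_point_mem e e.2 v h)
  filter_upwards [Ioo_mem_nhdsGT hε] with ρ hρ
  exact disjoint_right.2 fun x hx => h (closedBall_subset_ball hρ.2 hx)

theorem eventually_disjoint_closedBall {X : Type*} [MetricSpace X] {x y : X} (hxy : x ≠ y) :
    ∀ᶠ ρ in 𝓝[>] 0, Disjoint (closedBall x ρ) (closedBall y ρ) := by
  filter_upwards [Ioo_mem_nhdsGT (half_pos (dist_pos.2 hxy))] with ρ hρ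
  exact closedBall_disjoint_closedBall (by linarith [hρ.2])

theorem PlaneDrawing.exists_radius [Finite V] (D : PlaneDrawing G) : ∃ ρ > 0,
    (∀ u v, u ≠ v → Disjoint (closedBall (D.point u) ρ) (closedBall (D.point v) ρ)) ∧
      ∀ (e : G.edgeSet) (v : V), v ∉ e.1 → Disjoint (D.arc e) (closedBall (D.point v) ρ) := by
  have vertices : ∀ᶠ ρ in 𝓝[>] 0, ∀ u v, u ≠ v →
      Disjoint (closedBall (D.point u) ρ) (closedBall (D.point v) ρ) :=
    eventually_all.2 fun u => eventually_all.2 fun v => eventually_imp_distrib_left.2 fun huv =>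
      eventually_disjoint_closedBall (D.point_injective.ne huv)
  have edges : ∀ᶠ ρ in 𝓝[>] 0, ∀ (e : G.edgeSet) (v : V), v ∉ e.1 →
      Disjoint (D.arc e) (closedBall (D.point v) ρ) :=
    eventually_all.2 fun e => eventually_all.2 fun v => eventually_imp_distrib_left.2 fun hv =>
      D.eventually_disjoint_arc_closedBall hv
  obtain ⟨ρ, ⟨hv, he⟩, hρ⟩ := (vertices.and edges).and self_mem_nhdsWithin |>.exists
  exact ⟨ρ, hρ, hv, he⟩

theorem exists_last_mem_closedBall {X : Type*} [PseudoMetricSpace X] {f : ℝ → X} {x : X} {ρ a b : ℝ}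
    (hf : Continuous f) (hab : a ≤ b) (ha : f a ∈ closedBall x ρ) (hb : f b ∉ closedBall x ρ) :
    ∃ s ∈ Icc a b, dist (f s) x = ρ ∧ ∀ t ∈ Icc s b, f t ∈ closedBall x ρ → t = s := by
  have hdist : Continuous fun t => dist (f t) x := hf.dist continuous_const
  obtain ⟨s, ⟨hs, hsx⟩, s_last⟩ := (isCompact_Icc.inter_right
    (isClosed_le hdist continuous_const)).exists_isGreatest ⟨a, left_mem_Icc.2 hab, ha⟩
  have s_unique : ∀ t ∈ Icc s b, f t ∈ closedBall x ρ → t = s := fun t ht h =>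
    le_antisymm (s_last ⟨⟨hs.1.trans ht.1, ht.2⟩, h⟩) ht.1
  obtain ⟨t, ht, htρ⟩ :=
    intermediate_value_Icc hs.2 hdist.continuousOn ⟨hsx, (not_le.1 hb).le⟩
  exact ⟨s, hs, s_unique t ht htρ.le ▸ htρ, s_unique⟩

theorem exists_path_between_closedBalls {X : Type*} [PseudoMetricSpace X] {a b : X} (γ : Path a b)
    {ρ : ℝ} (hρ : 0 ≤ ρ) (hab : Disjoint (closedBall a ρ) (closedBall b ρ)) :
    ∃ (p q : X) (δ : Path p q), range δ ⊆ range γ ∧ dist p a = ρ ∧ dist q b = ρ ∧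
      range δ ∩ closedBall a ρ ⊆ {p} ∧ range δ ∩ closedBall b ρ ⊆ {q} := by
  obtain ⟨s, hs, hsa, last_in_a⟩ := exists_last_mem_closedBall (x := a) (ρ := ρ)
    γ.continuous_extend zero_le_one (by simpa)
    (by simpa using disjoint_right.1 hab (mem_closedBall_self hρ))
  -- The first visit to the ball around `b` is the last one in reversed time.
  obtain ⟨t, ht, htb, first_in_b⟩ := exists_last_mem_closedBall (x := b) (ρ := ρ)
    (a := -1) (b := -s) (γ.continuous_extend.comp continuous_neg) (by linarith [hs.2]) (by simpa)
    (by simpa using disjoint_left.1 hab (mem_closedBall.2 hsa.le))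
  have ht' : -t ∈ Icc s 1 := ⟨by linarith [ht.2], by linarith [ht.1]⟩
  let s' : unitInterval := ⟨s, hs⟩
  let t' : unitInterval := ⟨-t, hs.1.trans ht'.1, ht'.2⟩
  have extend_s : γ.extend s = γ s' := γ.extend_apply hs
  have extend_t : γ.extend (-t) = γ t' := γ.extend_apply t'.2
  have range_subpath : range (γ.subpath s' t') = γ '' Icc s' t' :=
    γ.range_subpath_of_le s' t' ht'.1
  refine ⟨γ s', γ t', γ.subpath s' t', range_subpath ▸ image_subset_range _ _, extend_s ▸ hsa,
    extend_t ▸ htb, ?_, ?_⟩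
  · rw [range_subpath]
    rintro _ ⟨⟨x, hx, rfl⟩, hxa⟩
    have := last_in_a x ⟨hx.1, x.2.2⟩ (by simpa using hxa)
    simp [s', ← this]
  · rw [range_subpath]
    rintro _ ⟨⟨x, hx, rfl⟩, hxb⟩
    have := first_in_b (-x) ⟨le_neg_of_le_neg hx.2, neg_le_neg hx.1⟩ (by simpa using hxb)
    simp [t', ← this]

/-- A drawing of a graph in the complex plane whose edges are radial near the vertices: the edge `e`
consists of the curve `middle e`, which runs outside the discs around the vertices, and for each of
its ends `v` of the radius of the disc around `v` in direction `angle e v`. The values of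
`angle e v` for `v ∉ e` do not matter. -/
structure RadialDrawing (G : SimpleGraph V) where
  point : V → ℂ
  radius : ℝ
  angle : G.edgeSet → V → ℝ
  middle : G.edgeSet → Set ℂ
  radius_pos : 0 < radius
  disjoint_closedBall : ∀ u v, u ≠ v →
    Disjoint (closedBall (point u) radius) (closedBall (point v) radius)
  exists_path : ∀ (e : G.edgeSet) (u v : V), e.1 = s(u, v) →
    ∃ γ : Path (circleMap (point u) radius (angle e u)) (circleMap (point v) radius (angle e v)),
      range γ = middle e
  middle_inter_closedBall : ∀ (e : G.edgeSet), ∀ v ∈ e.1,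
    middle e ∩ closedBall (point v) radius ⊆ {circleMap (point v) radius (angle e v)}
  disjoint_middle_closedBall : ∀ (e : G.edgeSet), ∀ v ∉ e.1,
    Disjoint (middle e) (closedBall (point v) radius)
  disjoint_middle : ∀ e f, e ≠ f → Disjoint (middle e) (middle f)

theorem exists_middle_between_closedBalls {p : V → ℂ} {ρ : ℝ} (hρ : 0 < ρ) {u v : V}
    (huv : Disjoint (closedBall (p u) ρ) (closedBall (p v) ρ)) (γ : Path (p u) (p v)) :
    ∃ (θ : V → ℝ) (M : Set ℂ), M ⊆ range γ ∧
      (∀ a b, s(u, v) = s(a, b) →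
        ∃ δ : Path (circleMap (p a) ρ (θ a)) (circleMap (p b) ρ (θ b)), range δ = M) ∧
      ∀ w ∈ s(u, v), M ∩ closedBall (p w) ρ ⊆ {circleMap (p w) ρ (θ w)} := by
  classical
  obtain ⟨x, y, δ, hδ, hx, hy, hδu, hδv⟩ := exists_path_between_closedBalls γ hρ.le huv
  have exists_angle {a z : ℂ} (h : dist z a = ρ) : ∃ θ, circleMap a ρ θ = z := by
    rw [← mem_range, range_circleMap, abs_of_pos hρ]
    exact h
  obtain ⟨α, rfl⟩ := exists_angle hx
  obtain ⟨β, rfl⟩ := exists_angle hy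
  have u_ne_v : v ≠ u := by
    rintro rfl
    exact disjoint_left.1 huv (mem_closedBall_self hρ.le) (mem_closedBall_self hρ.le)
  refine ⟨fun w => if w = u then α else β, range δ, hδ, fun a b hab => ?_, fun w hw => ?_⟩
  · rcases Sym2.eq_iff.1 hab with ⟨rfl, rfl⟩ | ⟨rfl, rfl⟩
    · exact ⟨δ.cast (by simp) (by simp [u_ne_v]), rfl⟩
    · exact ⟨δ.symm.cast (by simp [u_ne_v]) (by simp), δ.symm_range⟩
  · rcases Sym2.mem_iff.1 hw with rfl | rfl
    · simpa using hδu
    · simpa [u_ne_v] using hδv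

theorem PlaneDrawing.exists_middle (D : PlaneDrawing G) {ι : Plane → ℂ}
    (hι : Continuous ι) {ρ : ℝ} (hρ : 0 < ρ) (disjoint_balls : ∀ u v, u ≠ v →
      Disjoint (closedBall (ι (D.point u)) ρ) (closedBall (ι (D.point v)) ρ)) (e : G.edgeSet) :
    ∃ (θ : V → ℝ) (M : Set ℂ), M ⊆ ι '' D.arc e ∧
      (∀ u v, e.1 = s(u, v) → ∃ δ : Path (circleMap (ι (D.point u)) ρ (θ u))
        (circleMap (ι (D.point v)) ρ (θ v)), range δ = M) ∧
      ∀ w ∈ e.1, M ∩ closedBall (ι (D.point w)) ρ ⊆ {circleMap (ι (D.point w)) ρ (θ w)} := by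
  obtain ⟨e, he⟩ := e
  induction e with | _ u v
  obtain ⟨γ, -, hγ⟩ := D.isArcBetween u v he
  have range_map : range (γ.map hι) = ι '' D.arc s(u, v) := by
    rw [← hγ, ← range_comp, Path.map_coe]
  have := exists_middle_between_closedBalls (p := fun v => ι (D.point v)) hρ
    (disjoint_balls u v he.ne) (γ.map hι)
  rwa [range_map] at this

theorem IsPlanar.nonempty_radialDrawing [Finite V] (hG : IsPlanar G) :
    Nonempty (RadialDrawing G) := by
  obtain ⟨D⟩ := hG
  obtain ⟨ρ, hρ, vertices, edges⟩ := D.exists_radius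
  let ι : Plane ≃ₗᵢ[ℝ] ℂ := Complex.orthonormalBasisOneI.repr.symm
  have ball (v : V) : closedBall (ι (D.point v)) ρ = ι '' closedBall (D.point v) ρ :=
    (ι.image_closedBall _ _).symm
  have vertices_ι (u v : V) (huv : u ≠ v) :
      Disjoint (closedBall (ι (D.point u)) ρ) (closedBall (ι (D.point v)) ρ) := by
    rw [ball, ball, disjoint_image_iff ι.injective]
    exact vertices u v huv
  have edges_ι (e : G.edgeSet) (v : V) (hv : v ∉ e.1) :
      Disjoint (ι '' D.arc e) (closedBall (ι (D.point v)) ρ) := by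
    rw [ball, disjoint_image_iff ι.injective]
    exact edges e v hv
  have middles := D.exists_middle ι.continuous hρ vertices_ι
  choose angle middle middle_subset exists_path middle_inter using middles
  have point_notMem (e : G.edgeSet) (v : V) : ι (D.point v) ∉ middle e := by
    intro h
    have center_mem := mem_closedBall_self (x := ι (D.point v)) hρ.le
    by_cases hv : v ∈ e.1
    · exact circleMap_ne_center hρ.ne' (middle_inter e v hv ⟨h, center_mem⟩).symm
    · exact disjoint_left.1 (edges_ι e v hv) (middle_subset e h) center_mem
  refine ⟨⟨ι ∘ D.point, ρ, angle, middle, hρ, vertices_ι, exists_path, middle_inter,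
    fun e v hv => (edges_ι e v hv).mono_left (middle_subset e), fun e f hef => ?_⟩⟩
  refine disjoint_left.2 fun x hxe hxf => ?_
  obtain ⟨y, hye, rfl⟩ := middle_subset e hxe
  obtain ⟨z, hzf, hzy⟩ := middle_subset f hxf
  obtain rfl := ι.injective hzy
  obtain ⟨v, rfl⟩ := D.inter_subset e e.2 f f.2 (Subtype.coe_ne_coe.2 hef) ⟨hye, hzf⟩
  exact point_notMem e v hxe

namespace RadialDrawing

variable (D : RadialDrawing G) {e f : G.edgeSet} {v : V} {t : ℝ}

/-- The point in direction `t` on the circle around the vertex `v`. -/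
noncomputable abbrev circle (v : V) (t : ℝ) : ℂ := circleMap (D.point v) D.radius t

/-- The curve that represents the edge `e`. -/
def curve (e : G.edgeSet) : Set ℂ :=
  D.middle e ∪ ⋃ v ∈ e.1, segment ℝ (D.point v) (D.circle v (D.angle e v))

theorem exists_path_range_eq_curve {u v : V} (he : e.1 = s(u, v)) :
    ∃ γ : Path (D.point u) (D.point v), range γ = D.curve e := by
  obtain ⟨γ, hγ⟩ := D.exists_path e u v he
  refine ⟨((Path.segment _ _).trans γ).trans (Path.segment _ _), ?_⟩
  simp only [Path.trans_range, Path.range_segment, hγ, curve, he, Sym2.mem_iff, iUnion_or,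
    iUnion_union_distrib, iUnion_iUnion_eq_left, segment_symm ℝ _ (D.point v)]
  rw [union_comm (segment _ _ _), union_assoc]

theorem isClosed_curve : IsClosed (D.curve e) := by
  obtain ⟨e, he⟩ := e
  induction e with | _ u v
  obtain ⟨γ, hγ⟩ := D.exists_path_range_eq_curve (e := ⟨s(u, v), he⟩) rfl
  exact hγ ▸ (isCompact_range γ.continuous).isClosed

theorem circle_mem_middle (hv : v ∈ e.1) : D.circle v (D.angle e v) ∈ D.middle e := by
  obtain ⟨w, hw⟩ := Sym2.mem_iff_exists.1 hv
  obtain ⟨γ, hγ⟩ := D.exists_path e v w hw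
  exact hγ ▸ ⟨0, γ.source⟩

theorem isPreconnected_middle : IsPreconnected (D.middle e) := by
  obtain ⟨e, he⟩ := e
  induction e with | _ u v
  obtain ⟨γ, hγ⟩ := D.exists_path ⟨s(u, v), he⟩ u v rfl
  exact hγ ▸ isPreconnected_range γ.continuous

theorem dist_circle : dist (D.circle v t) (D.point v) = D.radius :=
  circleMap_mem_sphere _ D.radius_pos.le t

theorem circle_mem_closedBall : D.circle v t ∈ closedBall (D.point v) D.radius :=
  D.dist_circle.le

theorem segment_subset_closedBall :
    segment ℝ (D.point v) (D.circle v t) ⊆ closedBall (D.point v) D.radius :=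
  (convex_closedBall _ _).segment_subset (mem_closedBall_self D.radius_pos.le)
    D.circle_mem_closedBall

theorem eq_of_circle_mem_segment {s : ℝ}
    (h : D.circle v t ∈ segment ℝ (D.point v) (D.circle v s)) : D.circle v t = D.circle v s := by
  have := dist_add_dist_of_mem_segment h
  rw [dist_comm, D.dist_circle, dist_comm (D.point v), D.dist_circle] at this
  exact dist_le_zero.1 (by linarith)

theorem circle_mem_curve (h : D.circle v t ∈ D.curve e) :
    v ∈ e.1 ∧ D.circle v t = D.circle v (D.angle e v) := by
  rcases h with h | h
  · by_cases hv : v ∈ e.1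
    · exact ⟨hv, D.middle_inter_closedBall e v hv ⟨h, D.circle_mem_closedBall⟩⟩
    · exact (disjoint_left.1 (D.disjoint_middle_closedBall e v hv) h D.circle_mem_closedBall).elim
  · obtain ⟨w, hw, h⟩ := mem_iUnion₂.1 h
    obtain rfl : w = v := by
      by_contra hwv
      exact disjoint_left.1 (D.disjoint_closedBall w v hwv) (D.segment_subset_closedBall h)
        D.circle_mem_closedBall
    exact ⟨hw, D.eq_of_circle_mem_segment h⟩

theorem circle_angle_notMem_curve (hv : v ∈ e.1) (hef : e ≠ f) :
    D.circle v (D.angle e v) ∉ D.curve f := by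
  intro h
  obtain ⟨hvf, h⟩ := D.circle_mem_curve h
  exact disjoint_left.1 (D.disjoint_middle e f hef) (D.circle_mem_middle hv)
    (h ▸ D.circle_mem_middle hvf)

theorem disjoint_middle_curve (hef : e ≠ f) : Disjoint (D.middle e) (D.curve f) := by
  refine disjoint_left.2 fun x hx h => h.elim (disjoint_left.1 (D.disjoint_middle e f hef) hx)
    fun h => ?_
  obtain ⟨w, hw, h⟩ := mem_iUnion₂.1 h
  have x_mem_ball := D.segment_subset_closedBall h
  have hwe : w ∈ e.1 := by
    by_contra hwe
    exact disjoint_left.1 (D.disjoint_middle_closedBall e w hwe) hx x_mem_ball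
  obtain rfl : x = D.circle w (D.angle e w) := D.middle_inter_closedBall e w hwe ⟨hx, x_mem_ball⟩
  exact D.circle_angle_notMem_curve hwe hef (.inr (mem_biUnion hw h))

theorem radius_lt_dist {u v : V} (huv : u ≠ v) : D.radius < dist (D.point u) (D.point v) := by
  by_contra! h
  exact disjoint_left.1 (D.disjoint_closedBall u v huv) (mem_closedBall_self D.radius_pos.le)
    (mem_closedBall.2 h)

theorem point_ne_circle (w : V) : D.point w ≠ D.circle v t := by
  rcases eq_or_ne w v with rfl | hwv
  · exact (circleMap_ne_center D.radius_pos.ne').symm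
  · intro h
    have := D.radius_lt_dist hwv
    rw [h, D.dist_circle] at this
    exact this.false

theorem eventually_circle_notMem_curve [Finite V] (v : V) (θ : ℝ) :
    ∀ᶠ t in 𝓝[≠] θ, ∀ e, D.circle v t ∉ D.curve e := by
  refine eventually_all.2 fun e => ?_
  filter_upwards [eventually_circleMap_ne _ (D.circle v (D.angle e v)) D.radius_pos.ne' θ]
    with t ht h using ht (D.circle_mem_curve h).2

end RadialDrawing

end Drawings

section Parity

open Filter Topology Set Module

variable {V : Type*} {G : SimpleGraph V}

open scoped Classical in
theorem even_card_of_mem_cycleSpace [Fintype V] {C : G.edgeSet → ZMod 2} (hC : C ∈ cycleSpace G)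
    (v : V) : Even (Finset.card {e | C e ≠ 0 ∧ v ∈ e.1}) := by
  have boole_eq : ∀ a : ZMod 2, (if a ≠ 0 then 1 else 0) = a := by decide
  rw [← ZMod.natCast_eq_zero_iff_even, Finset.natCast_card_filter]
  refine Eq.trans ?_ (mem_cycleSpace.1 hC v)
  rw [Finset.sum_filter]
  refine Finset.sum_congr rfl fun e _ => ?_
  by_cases hv : v ∈ e.1 <;> simp only [hv, and_true, and_false, boole_eq, if_true, if_false]

theorem stdAddChar_one : ZMod.stdAddChar (1 : ZMod 2) = -1 := by
  have := ZMod.stdAddChar_coe (N := 2) 1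
  push_cast at this
  rw [this, ← Complex.exp_pi_mul_I]
  ring_nf

theorem sym2_eq_of_add_eq_of_add_eq {M : Type*} [AddCommGroup M] [Module (ZMod 2) M]
    {l r l' r' ε : Dual (ZMod 2) M} (h : l + r = ε) (h' : l' + r' = ε)
    (eq_on_ker : ∀ x, ε x = 0 → l x = l' x) : s(l, r) = s(l', r') := by
  have add_self (φ : Dual (ZMod 2) M) : φ + φ = 0 :=
    LinearMap.ext fun _ => CharTwo.add_self_eq_zero _
  have sub_mem_span : l - l' ∈ Submodule.span (ZMod 2) (range fun _ : Unit => ε) :=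
    mem_span_of_iInf_ker_le_ker fun x hx => by
      simpa [sub_eq_zero] using eq_on_ker x (by simpa using hx)
  rw [range_const, Submodule.mem_span_singleton] at sub_mem_span
  obtain ⟨c, hc⟩ := sub_mem_span
  obtain rfl | rfl := (by decide : ∀ c : ZMod 2, c = 0 ∨ c = 1) c
  · obtain rfl : l = l' := sub_eq_zero.1 (by rw [← hc, zero_smul])
    rw [add_left_cancel (h.trans h'.symm)]
  · obtain rfl : l = r' := by
      rw [one_smul, ← h', eq_sub_iff_add_eq] at hc
      rw [← hc, add_right_comm, add_self, zero_add]
    rw [add_left_cancel (h.trans (h'.symm.trans (add_comm _ _))), Sym2.eq_swap]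

namespace RadialDrawing

variable (D : RadialDrawing G) {e f : G.edgeSet} {v : V} {t : ℝ}

open scoped Classical in
theorem exists_continuousOn_sq_eq [Fintype V] (e : G.edgeSet) : ∃ h : ℂ → ℂ,
    ContinuousOn h (D.curve e)ᶜ ∧ ∀ x ∉ D.curve e, h x ^ 2 = ∏ v with v ∈ e.1, (D.point v - x) := by
  obtain ⟨⟨u, v⟩, huv⟩ := Sym2.mk_surjective e.1
  obtain ⟨γ, hγ⟩ := D.exists_path_range_eq_curve huv.symm
  simpa only [prod_ends huv.symm, hγ] using exists_continuousOn_compl_range_sq_eq γ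

/-- A continuous square root of `x ↦ (p - x) * (q - x)` off the curve of the edge `e`, where `p` and
`q` are the ends of that curve. -/
noncomputable def sqrt [Fintype V] (e : G.edgeSet) : ℂ → ℂ :=
  (D.exists_continuousOn_sq_eq e).choose

theorem continuousOn_sqrt [Fintype V] : ContinuousOn (D.sqrt e) (D.curve e)ᶜ :=
  (D.exists_continuousOn_sq_eq e).choose_spec.1

open scoped Classical in
theorem sqrt_sq [Fintype V] {x : ℂ} (hx : x ∉ D.curve e) :
    D.sqrt e x ^ 2 = ∏ v with v ∈ e.1, (D.point v - x) :=
  (D.exists_continuousOn_sq_eq e).choose_spec.2 x hx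

open scoped Classical in
/-- The sign, written additively, that compares the square root chosen for the edge `e` with the
product of the principal square roots of the two factors. -/
noncomputable def signBit [Fintype V] (e : G.edgeSet) (x : ℂ) : ZMod 2 :=
  if D.sqrt e x = ∏ v with v ∈ e.1, (D.point v - x) ^ (2⁻¹ : ℂ) then 0 else 1

open scoped Classical in
theorem sqrt_eq [Fintype V] {x : ℂ} (hx : x ∉ D.curve e) :
    D.sqrt e x =
      ZMod.stdAddChar (D.signBit e x) * ∏ v with v ∈ e.1, (D.point v - x) ^ (2⁻¹ : ℂ) := by
  have sq_eq : D.sqrt e x ^ 2 = (∏ v with v ∈ e.1, (D.point v - x) ^ (2⁻¹ : ℂ)) ^ 2 := by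
    simp only [D.sqrt_sq hx, ← Finset.prod_pow, Complex.cpow_ofNat_inv_pow]
  rw [signBit]
  split_ifs with h
  · simpa using h
  · rw [stdAddChar_one, neg_one_mul]
    exact (sq_eq_sq_iff_eq_or_eq_neg.1 sq_eq).resolve_left h

open scoped Classical in
/-- Tells, for every element `C` of the cycle space, on which side of the curves of `C` the point
`x` lies. Which side gets the value `0` depends on the choice of `sqrt`: by `prod_sqrt_eq`, the
value is the sign by which `evenRoot C` and the product of `sqrt e` along `C`, two square roots of
the same polynomial, differ at `x`. -/
noncomputable def parity [Fintype V] (x : ℂ) : Dual (ZMod 2) (cycleSpace G) :=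
  (∑ e, D.signBit e x • LinearMap.proj e) ∘ₗ (cycleSpace G).subtype

open scoped Classical in
theorem parity_apply [Fintype V] (x : ℂ) (C : cycleSpace G) :
    D.parity x C = ∑ e, D.signBit e x * C.1 e := by
  simp [parity]

open scoped Classical in
/-- The polynomial in `x` whose square is the product of `(p - x) * (q - x)` over the edges of the
even edge set `C`, where `p` and `q` are the ends of the edge. -/
noncomputable def evenRoot [Fintype V] (C : cycleSpace G) (x : ℂ) : ℂ :=
  ∏ v, (D.point v - x) ^ (Finset.card {e | C.1 e ≠ 0 ∧ v ∈ e.1} / 2)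

open scoped Classical in
theorem prod_sqrt_eq [Fintype V] {x : ℂ} {C : cycleSpace G} (hx : ∀ e, C.1 e ≠ 0 → x ∉ D.curve e) :
    ∏ e with C.1 e ≠ 0, D.sqrt e x = ZMod.stdAddChar (D.parity x C) * D.evenRoot C x := by
  have sum_signBit : ∑ e with C.1 e ≠ 0, D.signBit e x = D.parity x C := by
    have ite_eq_mul : ∀ a b : ZMod 2, (if a ≠ 0 then b else 0) = b * a := by decide
    simp only [D.parity_apply, Finset.sum_filter, ite_eq_mul]
  have prod_sign : ∏ e with C.1 e ≠ 0, ZMod.stdAddChar (D.signBit e x) =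
      ZMod.stdAddChar (D.parity x C) := by
    rw [← sum_signBit]
    exact (map_prod ZMod.stdAddChar.toMonoidHom
      (fun e => Multiplicative.ofAdd (D.signBit e x)) _).symm
  calc ∏ e with C.1 e ≠ 0, D.sqrt e x
      = ∏ e with C.1 e ≠ 0, ZMod.stdAddChar (D.signBit e x) *
          ∏ v with v ∈ e.1, (D.point v - x) ^ (2⁻¹ : ℂ) :=
        Finset.prod_congr rfl fun e he => D.sqrt_eq (hx e (by simpa using he))
    _ = ZMod.stdAddChar (D.parity x C) *
          ∏ e with C.1 e ≠ 0, ∏ v with v ∈ e.1, (D.point v - x) ^ (2⁻¹ : ℂ) := by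
        rw [Finset.prod_mul_distrib, prod_sign]
    _ = ZMod.stdAddChar (D.parity x C) *
          ∏ v, ∏ e with C.1 e ≠ 0 ∧ v ∈ e.1, (D.point v - x) ^ (2⁻¹ : ℂ) := by
        rw [Finset.prod_comm' (t' := .univ) (s' := fun v => {e | C.1 e ≠ 0 ∧ v ∈ e.1})
          (by simp [and_comm])]
    _ = ZMod.stdAddChar (D.parity x C) * D.evenRoot C x := by
        rw [evenRoot]
        congr! 2 with v
        obtain ⟨n, hn⟩ := (even_card_of_mem_cycleSpace C.2 v).two_dvd
        rw [Finset.prod_const, hn, pow_mul, Complex.cpow_ofNat_inv_pow,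
          Nat.mul_div_cancel_left _ two_pos]

theorem point_mem_curve (hv : v ∈ e.1) : D.point v ∈ D.curve e :=
  .inr (mem_biUnion hv (left_mem_segment ℝ _ _))

theorem continuous_evenRoot [Fintype V] (C : cycleSpace G) : Continuous (D.evenRoot C) := by
  unfold evenRoot
  fun_prop

theorem evenRoot_ne_zero [Fintype V] {x : ℂ} {C : cycleSpace G}
    (hx : ∀ e, C.1 e ≠ 0 → ∀ v ∈ e.1, D.point v ≠ x) : D.evenRoot C x ≠ 0 := by
  classical
  refine Finset.prod_ne_zero_iff.2 fun v _ => ?_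
  rcases Finset.eq_empty_or_nonempty {e | C.1 e ≠ 0 ∧ v ∈ e.1} with h | ⟨e, he⟩
  · simp [h]
  · obtain ⟨he, hv⟩ := (Finset.mem_filter.1 he).2
    exact pow_ne_zero _ (sub_ne_zero.2 (hx e he v hv))

theorem continuousOn_prod_sqrt [Fintype V] (s : Finset G.edgeSet) :
    ContinuousOn (fun x => ∏ e ∈ s, D.sqrt e x) {x | ∀ e ∈ s, x ∉ D.curve e} :=
  continuousOn_finsetProd _ fun e he => D.continuousOn_sqrt.mono fun _ hx => hx e he

theorem parity_eq_of_isPreconnected [Fintype V] {S : Set ℂ} (hS : IsPreconnected S)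
    {C : cycleSpace G} (hSC : ∀ e, C.1 e ≠ 0 → Disjoint S (D.curve e)) {x y : ℂ} (hx : x ∈ S)
    (hy : y ∈ S) : D.parity x C = D.parity y C := by
  classical
  have notMem_curve (z : ℂ) (hz : z ∈ S) (e : G.edgeSet) (he : C.1 e ≠ 0) : z ∉ D.curve e :=
    disjoint_left.1 (hSC e he) hz
  have evenRoot_ne_zero (z : ℂ) (hz : z ∈ S) : D.evenRoot C z ≠ 0 :=
    D.evenRoot_ne_zero fun e he v hv h => notMem_curve z hz e he (h ▸ D.point_mem_curve hv)
  have sign_sq (a : ZMod 2) : ZMod.stdAddChar a ^ 2 = 1 := by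
    rw [← AddChar.map_nsmul_eq_pow, two_nsmul, CharTwo.add_self_eq_zero, AddChar.map_zero_eq_one]
  obtain ⟨s, hs⟩ : ∃ s, ∀ z ∈ S, ∏ e with C.1 e ≠ 0, D.sqrt e z = s * D.evenRoot C z := by
    rcases hS.eq_or_eq_neg_of_sq_eq
      ((D.continuousOn_prod_sqrt {e | C.1 e ≠ 0}).mono fun z hz e he =>
        notMem_curve z hz e (by simpa using he))
      (D.continuous_evenRoot C).continuousOn
      (fun z hz => by simp [D.prod_sqrt_eq (notMem_curve z hz), mul_pow, sign_sq])
      (fun hz => evenRoot_ne_zero _ hz) with h | h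
    · exact ⟨1, fun z hz => (h hz).trans (one_mul _).symm⟩
    · exact ⟨-1, fun z hz => (h hz).trans (neg_one_mul _).symm⟩
  have sign_eq (z : ℂ) (hz : z ∈ S) : ZMod.stdAddChar (D.parity z C) = s :=
    mul_right_cancel₀ (evenRoot_ne_zero z hz)
      ((D.prod_sqrt_eq (notMem_curve z hz)).symm.trans (hs z hz))
  exact ZMod.injective_stdAddChar ((sign_eq x hx).trans (sign_eq y hy).symm)

theorem eventually_parity_eq [Fintype V] {x : ℂ} {C : cycleSpace G}
    (hx : ∀ e, C.1 e ≠ 0 → x ∉ D.curve e) : ∀ᶠ y in 𝓝 x, D.parity y C = D.parity x C := by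
  have nhds : ⋂ e, {y | C.1 e ≠ 0 → y ∉ D.curve e} ∈ 𝓝 x :=
    iInter_mem.2 fun e => eventually_imp_distrib_left.2 fun he =>
      D.isClosed_curve.isOpen_compl.mem_nhds (hx e he)
  obtain ⟨ε, hε, hball⟩ := Metric.mem_nhds_iff.1 nhds
  filter_upwards [Metric.ball_mem_nhds x hε] with y hy
  exact D.parity_eq_of_isPreconnected (convex_ball x ε).isPreconnected
    (fun e he => disjoint_left.2 fun z hz => mem_iInter.1 (hball hz) e he) hy
    (Metric.mem_ball_self hε)

theorem exists_left_right_parity [Fintype V] (v : V) (θ : ℝ) :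
    ∃ l r : Dual (ZMod 2) (cycleSpace G), (∀ᶠ t in 𝓝[<] θ, D.parity (D.circle v t) = l) ∧
      ∀ᶠ t in 𝓝[>] θ, D.parity (D.circle v t) = r := by
  have off_curves := D.eventually_circle_notMem_curve v θ
  rw [← Iio_union_Ioi, nhdsWithin_union, eventually_sup] at off_curves
  have parity_const {I : Set ℝ} (hI : IsPreconnected I)
      (h : ∀ t ∈ I, ∀ e, D.circle v t ∉ D.curve e) {s t : ℝ} (hs : s ∈ I) (ht : t ∈ I) :
      D.parity (D.circle v s) = D.parity (D.circle v t) :=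
    LinearMap.ext fun C => D.parity_eq_of_isPreconnected
      (hI.image _ (continuous_circleMap _ _).continuousOn)
      (fun e _ => disjoint_left.2 (forall_mem_image.2 fun t ht => h t ht e))
      (mem_image_of_mem _ hs) (mem_image_of_mem _ ht)
  obtain ⟨a, ha, left⟩ := (mem_nhdsLT_iff_exists_Ioo_subset).1 off_curves.1
  obtain ⟨b, hb, right⟩ := (mem_nhdsGT_iff_exists_Ioo_subset).1 off_curves.2
  obtain ⟨s, hs⟩ := nonempty_Ioo.2 (mem_Iio.1 ha)
  obtain ⟨t, ht⟩ := nonempty_Ioo.2 (mem_Ioi.1 hb)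
  refine ⟨D.parity (D.circle v s), D.parity (D.circle v t), ?_, ?_⟩
  · filter_upwards [Ioo_mem_nhdsLT ha] with u hu using parity_const isPreconnected_Ioo left hu hs
  · filter_upwards [Ioo_mem_nhdsGT hb] with u hu using parity_const isPreconnected_Ioo right hu ht

/-- The value of the parity just before direction `θ` on the circle around `v`. -/
noncomputable def leftParity [Fintype V] (v : V) (θ : ℝ) : Dual (ZMod 2) (cycleSpace G) :=
  (D.exists_left_right_parity v θ).choose

/-- The value of the parity just after direction `θ` on the circle around `v`. -/
noncomputable def rightParity [Fintype V] (v : V) (θ : ℝ) : Dual (ZMod 2) (cycleSpace G) :=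
  (D.exists_left_right_parity v θ).choose_spec.choose

theorem eventually_parity_eq_leftParity [Fintype V] (v : V) (θ : ℝ) :
    ∀ᶠ t in 𝓝[<] θ, D.parity (D.circle v t) = D.leftParity v θ :=
  (D.exists_left_right_parity v θ).choose_spec.choose_spec.1

theorem eventually_parity_eq_rightParity [Fintype V] (v : V) (θ : ℝ) :
    ∀ᶠ t in 𝓝[>] θ, D.parity (D.circle v t) = D.rightParity v θ :=
  (D.exists_left_right_parity v θ).choose_spec.choose_spec.2

theorem eventually_parity_circle_eq [Fintype V] {C : cycleSpace G}
    (h : ∀ e, C.1 e ≠ 0 → D.circle v t ∉ D.curve e) :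
    ∀ᶠ s in 𝓝 t, D.parity (D.circle v s) C = D.parity (D.circle v t) C :=
  (continuous_circleMap _ _).continuousAt.eventually (D.eventually_parity_eq h)

theorem leftParity_apply [Fintype V] {C : cycleSpace G}
    (h : ∀ e, C.1 e ≠ 0 → D.circle v t ∉ D.curve e) :
    D.leftParity v t C = D.parity (D.circle v t) C := by
  obtain ⟨s, hl, hs⟩ := ((D.eventually_parity_eq_leftParity v t).and
    ((D.eventually_parity_circle_eq h).filter_mono nhdsWithin_le_nhds)).exists
  rw [← hl, hs]

theorem rightParity_apply [Fintype V] {C : cycleSpace G}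
    (h : ∀ e, C.1 e ≠ 0 → D.circle v t ∉ D.curve e) :
    D.rightParity v t C = D.parity (D.circle v t) C := by
  obtain ⟨s, hr, hs⟩ := ((D.eventually_parity_eq_rightParity v t).and
    ((D.eventually_parity_circle_eq h).filter_mono nhdsWithin_le_nhds)).exists
  rw [← hr, hs]

theorem leftParity_eq_rightParity [Fintype V] (h : ∀ e, D.circle v t ∉ D.curve e) :
    D.leftParity v t = D.rightParity v t :=
  LinearMap.ext fun _ => (D.leftParity_apply fun e _ => h e).trans
    (D.rightParity_apply fun e _ => h e).symm

theorem circle_ne_circle {θ : ℝ} (ht : t ∈ Ioo θ (θ + 2 * Real.pi)) :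
    D.circle v t ≠ D.circle v θ := by
  refine fun h => ht.1.ne' (eq_of_circleMap_eq D.radius_pos.ne' ?_ h)
  rw [abs_of_pos (sub_pos.2 ht.1)]
  linarith [ht.2]

theorem exists_tendsto_sqrt_circle [Fintype V] (hv : v ∈ e.1) : ∃ z : ℂ,
    Tendsto (fun t => D.sqrt e (D.circle v t)) (𝓝[<] D.angle e v) (𝓝 (-z)) ∧
      Tendsto (fun t => D.sqrt e (D.circle v t)) (𝓝[>] D.angle e v) (𝓝 z) := by
  obtain ⟨w, hw⟩ := Sym2.mem_iff_exists.1 hv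
  have hvw : v ≠ w := G.ne_of_adj (G.mem_edgeSet.1 (hw ▸ e.2))
  have notMem_curve : ∀ x ∈ D.circle v '' Ioo (D.angle e v) (D.angle e v + 2 * Real.pi),
      x ∉ D.curve e := by
    rintro _ ⟨t, ht, rfl⟩ h
    exact D.circle_ne_circle ht (D.circle_mem_curve h).2
  obtain ⟨k, k_continuous, after, before⟩ := exists_continuous_eq_and_eq_neg_of_sq_eq
    (q := D.point w) D.radius_pos.ne'
    (by rw [abs_of_pos D.radius_pos]; exact D.radius_lt_dist hvw.symm)
    (D.continuousOn_sqrt.mono notMem_curve)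
    (fun x hx => by rw [D.sqrt_sq (notMem_curve x hx), prod_ends hw])
  refine ⟨k (D.angle e v), ?_, ?_⟩
  · refine ((k_continuous.neg.tendsto _).mono_left nhdsWithin_le_nhds).congr' ?_
    filter_upwards [Ioo_mem_nhdsLT (sub_lt_self _ Real.two_pi_pos)] with t ht
      using (before t ht).symm
  · refine ((k_continuous.tendsto _).mono_left nhdsWithin_le_nhds).congr' ?_
    filter_upwards [Ioo_mem_nhdsGT (lt_add_of_pos_right _ Real.two_pi_pos)] with t ht
      using (after t ht).symm

open scoped Classical in
theorem mul_prod_sqrt_eq_of_tendsto [Fintype V] (hv : v ∈ e.1) {C : cycleSpace G} (hC : C.1 e ≠ 0)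
    {F : Filter ℝ} [F.NeBot] (hF : F ≤ 𝓝[≠] D.angle e v) {φ : Dual (ZMod 2) (cycleSpace G)} {z : ℂ}
    (hφ : ∀ᶠ t in F, D.parity (D.circle v t) = φ)
    (hz : Tendsto (fun t => D.sqrt e (D.circle v t)) F (𝓝 z)) :
    z * ∏ f ∈ Finset.erase {f | C.1 f ≠ 0} e, D.sqrt f (D.circle v (D.angle e v)) =
      ZMod.stdAddChar (φ C) * D.evenRoot C (D.circle v (D.angle e v)) := by
  have hF' : F ≤ 𝓝 (D.angle e v) := hF.trans nhdsWithin_le_nhds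
  have tendsto_others : Tendsto
      (fun t => ∏ f ∈ Finset.erase {f | C.1 f ≠ 0} e, D.sqrt f (D.circle v t)) (𝓝 (D.angle e v))
      (𝓝 (∏ f ∈ Finset.erase {f | C.1 f ≠ 0} e, D.sqrt f (D.circle v (D.angle e v)))) :=
    tendsto_finsetProd _ fun f hf => (D.continuousOn_sqrt.continuousAt
      (D.isClosed_curve.isOpen_compl.mem_nhds
        (D.circle_angle_notMem_curve hv (Finset.ne_of_mem_erase hf).symm))).tendsto.comp
      (continuous_circleMap _ _).continuousAt
  have tendsto_evenRoot : Tendsto (fun t => D.evenRoot C (D.circle v t)) (𝓝 (D.angle e v))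
      (𝓝 (D.evenRoot C (D.circle v (D.angle e v)))) :=
    ((D.continuous_evenRoot C).comp (continuous_circleMap _ _)).tendsto _
  refine tendsto_nhds_unique_of_eventuallyEq (hz.mul (tendsto_others.mono_left hF'))
    ((tendsto_evenRoot.mono_left hF').const_mul _) ?_
  filter_upwards [hF (D.eventually_circle_notMem_curve v _), hφ] with t ht hφ
  rw [Finset.mul_prod_erase _ (fun f => D.sqrt f (D.circle v t)) (by simpa using hC),
    D.prod_sqrt_eq fun f _ => ht f, hφ]

theorem leftParity_add_rightParity_apply_eq_one [Fintype V] (hv : v ∈ e.1) {C : cycleSpace G}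
    (hC : C.1 e ≠ 0) :
    D.leftParity v (D.angle e v) C + D.rightParity v (D.angle e v) C = 1 := by
  obtain ⟨z, before, after⟩ := D.exists_tendsto_sqrt_circle hv
  have left := D.mul_prod_sqrt_eq_of_tendsto hv hC (nhdsLT_le_nhdsNE _)
    (D.eventually_parity_eq_leftParity v _) before
  have right := D.mul_prod_sqrt_eq_of_tendsto hv hC (nhdsGT_le_nhdsNE _)
    (D.eventually_parity_eq_rightParity v _) after
  rw [neg_mul, right, ← neg_mul] at left
  have sign_left := mul_right_cancel₀ (D.evenRoot_ne_zero fun _ _ w _ => D.point_ne_circle w) left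
  rw [← neg_one_mul, ← stdAddChar_one, ← AddChar.map_add_eq_mul] at sign_left
  rw [← ZMod.injective_stdAddChar sign_left, add_assoc, CharTwo.add_self_eq_zero, add_zero]

theorem leftParity_add_rightParity_apply [Fintype V] (hv : v ∈ e.1) (C : cycleSpace G) :
    D.leftParity v (D.angle e v) C + D.rightParity v (D.angle e v) C = C.1 e := by
  by_cases hC : C.1 e = 0
  · have off_curves (f : G.edgeSet) (hf : C.1 f ≠ 0) : D.circle v (D.angle e v) ∉ D.curve f :=
      D.circle_angle_notMem_curve hv (by rintro rfl; exact hf hC)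
    rw [D.leftParity_apply off_curves, D.rightParity_apply off_curves, hC,
      CharTwo.add_self_eq_zero]
  · have eq_one : ∀ a : ZMod 2, a ≠ 0 → a = 1 := by decide
    rw [D.leftParity_add_rightParity_apply_eq_one hv hC, eq_one _ hC]

theorem leftParity_eq_of_circle_eq [Fintype V] {s : ℝ} (h : D.circle v s = D.circle v t) :
    D.leftParity v s = D.leftParity v t :=
  eq_of_periodic_of_circleMap_eq (periodic_of_eventually_eq (tendsto_add_const_nhdsLT _)
    (D.eventually_parity_eq_leftParity v) ((periodic_circleMap _ _).comp D.parity))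
    D.radius_pos.ne' h

theorem rightParity_eq_of_circle_eq [Fintype V] {s : ℝ} (h : D.circle v s = D.circle v t) :
    D.rightParity v s = D.rightParity v t :=
  eq_of_periodic_of_circleMap_eq (periodic_of_eventually_eq (tendsto_add_const_nhdsGT _)
    (D.eventually_parity_eq_rightParity v) ((periodic_circleMap _ _).comp D.parity))
    D.radius_pos.ne' h

theorem sym2_leftParity_rightParity_eq [Fintype V] {w : V} (hv : v ∈ e.1) (hw : w ∈ e.1) :
    s(D.leftParity v (D.angle e v), D.rightParity v (D.angle e v)) =
      s(D.leftParity w (D.angle e w), D.rightParity w (D.angle e w)) := by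
  refine sym2_eq_of_add_eq_of_add_eq (ε := LinearMap.proj e ∘ₗ (cycleSpace G).subtype)
    (LinearMap.ext (D.leftParity_add_rightParity_apply hv))
    (LinearMap.ext (D.leftParity_add_rightParity_apply hw)) fun C hC => ?_
  have ne_of_mem (f : G.edgeSet) (hf : C.1 f ≠ 0) : e ≠ f := fun h => hf (h ▸ hC)
  rw [D.leftParity_apply fun f hf => D.circle_angle_notMem_curve hv (ne_of_mem f hf),
    D.leftParity_apply fun f hf => D.circle_angle_notMem_curve hw (ne_of_mem f hf)]
  exact D.parity_eq_of_isPreconnected D.isPreconnected_middle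
    (fun f hf => D.disjoint_middle_curve (ne_of_mem f hf))
    (D.circle_mem_middle hv) (D.circle_mem_middle hw)

open scoped Classical in
/-- The faces on the two sides of the edge `e`, each given by the parities of its points; there are
none if both sides have the same parities. -/
noncomputable def sides [Fintype V] (e : G.edgeSet) : Finset (Dual (ZMod 2) (cycleSpace G)) :=
  symmDiff {D.leftParity e.1.out.1 (D.angle e e.1.out.1)}
    {D.rightParity e.1.out.1 (D.angle e e.1.out.1)}

open scoped Classical in
theorem sides_eq [Fintype V] (hv : v ∈ e.1) :
    D.sides e = symmDiff {D.leftParity v (D.angle e v)} {D.rightParity v (D.angle e v)} := by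
  rw [sides]
  rcases Sym2.eq_iff.1 (D.sym2_leftParity_rightParity_eq (Sym2.out_fst_mem e.1) hv) with
    ⟨hl, hr⟩ | ⟨hl, hr⟩
  · rw [hl, hr]
  · rw [hl, hr, symmDiff_comm]

theorem mem_sides [Fintype V] (hv : v ∈ e.1) {φ : Dual (ZMod 2) (cycleSpace G)} :
    φ ∈ D.sides e ↔ ¬ (φ = D.leftParity v (D.angle e v) ↔ φ = D.rightParity v (D.angle e v)) := by
  classical
  rw [D.sides_eq hv, Finset.mem_symmDiff, Finset.mem_singleton, Finset.mem_singleton]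
  tauto

theorem card_sides_le [Fintype V] (e : G.edgeSet) : (D.sides e).card ≤ 2 := by
  classical exact (Finset.card_le_card symmDiff_le_sup).trans (Finset.card_union_le _ _)

theorem sum_sides_apply [Fintype V] (e : G.edgeSet) (C : cycleSpace G) :
    ∑ φ ∈ D.sides e, φ C = C.1 e := by
  classical
  rw [← D.leftParity_add_rightParity_apply (Sym2.out_fst_mem e.1) C, sides]
  by_cases h : D.leftParity e.1.out.1 (D.angle e e.1.out.1) =
    D.rightParity e.1.out.1 (D.angle e e.1.out.1)
  · rw [h, symmDiff_self, Finset.bot_eq_empty, Finset.sum_empty, CharTwo.add_self_eq_zero]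
  · rw [(Finset.disjoint_singleton.2 h).symmDiff_eq_sup, Finset.sup_eq_union,
      Finset.sum_union (Finset.disjoint_singleton.2 h), Finset.sum_singleton, Finset.sum_singleton]

theorem exists_ne_mem_sides [Fintype V] {φ : Dual (ZMod 2) (cycleSpace G)} (hφ : φ ∈ D.sides e)
    (hv : v ∈ e.1) : ∃ f, f ≠ e ∧ v ∈ f.1 ∧ φ ∈ D.sides f := by
  by_contra! no_other
  have no_jump : ∀ θ ∈ Ioo (D.angle e v) (D.angle e v + 2 * Real.pi),
      (φ = D.leftParity v θ) = (φ = D.rightParity v θ) := by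
    intro θ hθ
    by_cases h : ∀ f, D.circle v θ ∉ D.curve f
    · rw [D.leftParity_eq_rightParity h]
    · push Not at h
      obtain ⟨f, hf⟩ := h
      obtain ⟨hvf, circle_eq⟩ := D.circle_mem_curve hf
      have hfe : f ≠ e := by
        rintro rfl
        exact D.circle_ne_circle hθ circle_eq
      rw [D.leftParity_eq_of_circle_eq circle_eq, D.rightParity_eq_of_circle_eq circle_eq]
      exact propext (not_not.1 fun h => no_other f hfe hvf ((D.mem_sides hvf).2 h))
  have jump := (D.mem_sides hv).1 hφ
  refine jump (iff_of_eq (leftValue_eq_rightValue_of_periodic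
    (f := fun t => φ = D.parity (D.circle v t)) (fun θ => ?_) (fun θ => ?_) Real.two_pi_pos
    ((periodic_circleMap _ _).comp (φ = D.parity ·)) no_jump))
  · exact (D.eventually_parity_eq_leftParity v θ).mono fun t ht => by rw [ht]
  · exact (D.eventually_parity_eq_rightParity v θ).mono fun t ht => by rw [ht]

end RadialDrawing

end Parity

section AverageDegree

theorem IsPlanar.mul_ncard_edgeSet_le {V : Type*} [Finite V] [Nonempty V] {G : SimpleGraph V}
    (hG : IsPlanar G) {g : ℕ} (hg : (g : ℕ∞) ≤ G.egirth) :
    g * (G.edgeSet.ncard + 1) ≤ 2 * G.edgeSet.ncard + g * Nat.card V := by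
  classical
  have : Fintype V := Fintype.ofFinite V
  obtain ⟨D⟩ := hG.nonempty_radialDrawing
  have faces_bound := mul_finrank_le_of_sides hg D.sides D.card_sides_le D.sum_sides_apply
    fun e φ hφ v hv => D.exists_ne_mem_sides hφ hv
  have euler := card_edgeSet_add_one_le_card_add_finrank_cycleSpace G
  rw [← Nat.card_coe_set_eq, Nat.card_eq_fintype_card, Nat.card_eq_fintype_card]
  nlinarith

theorem IsPlanar.of_injective {V W : Type*} {G : SimpleGraph V} {H : SimpleGraph W}
    (hG : IsPlanar G) (f : H →g G) (hf : Function.Injective f) : IsPlanar H := by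
  obtain ⟨D⟩ := hG
  have map_mem : ∀ e ∈ H.edgeSet, e.map f ∈ G.edgeSet := fun e he => f.map_mem_edgeSet he
  refine ⟨{
    point := fun w => D.point (f w)
    arc := fun e => D.arc (e.map f)
    point_injective := D.point_injective.comp hf
    isArcBetween := fun u v h => D.isArcBetween (f u) (f v) (f.map_adj h)
    mem_of_point_mem := fun e he w hw => ?_
    inter_subset := fun e he e' he' hne x hx => ?_ }⟩
  · obtain ⟨u, hu, huw⟩ := Sym2.mem_map.1 (D.mem_of_point_mem _ (map_mem e he) _ hw)
    rwa [← hf huw]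
  · obtain ⟨v, rfl⟩ := D.inter_subset _ (map_mem e he) _ (map_mem e' he')
      (fun h => hne (Sym2.map.injective hf h)) hx
    obtain ⟨u, -, rfl⟩ := Sym2.mem_map.1 (D.mem_of_point_mem _ (map_mem e he) v hx.1)
    exact ⟨u, rfl⟩

variable {V : Type*} {G : SimpleGraph V}

theorem mad_of_isEmpty [IsEmpty V] : mad G = 0 := by
  have no_degrees : subgraphAverageDegrees G = ∅ := by
    refine Set.eq_empty_of_forall_notMem ?_
    rintro x ⟨H, h, -⟩
    simp [Set.eq_empty_of_isEmpty H.verts] at h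
  rw [mad, no_degrees, Real.sSup_empty]

theorem ncard_edgeSet_coe (H : G.Subgraph) : H.coe.edgeSet.ncard = H.edgeSet.ncard := by
  rw [← H.image_coe_edgeSet_coe,
    Set.ncard_image_of_injective _ (Sym2.map.injective Subtype.val_injective)]

theorem IsPlanar.mul_ncard_edgeSet_subgraph_le [Finite V] (hG : IsPlanar G) {g : ℕ}
    (hg : (g : ℕ∞) ≤ G.egirth) {H : G.Subgraph} (hH : H.verts.Nonempty) :
    g * (H.edgeSet.ncard + 1) ≤ 2 * H.edgeSet.ncard + g * H.verts.ncard := by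
  have : Nonempty H.verts := hH.to_subtype
  have girth_le : (g : ℕ∞) ≤ H.coe.egirth :=
    hg.trans (SimpleGraph.IsContained.egirth_le ⟨H.hom, H.hom_injective⟩)
  simpa only [ncard_edgeSet_coe, Nat.card_coe_set_eq] using
    (hG.of_injective H.hom H.hom_injective).mul_ncard_edgeSet_le girth_le

end AverageDegree

theorem mainTheorem9 {V : Type*} [Finite V] (G : SimpleGraph V) (hG : IsPlanar G)
    (g : ℕ) (hg : 3 ≤ g) (hgirth : (g : ℕ∞) ≤ G.egirth) :
    mad G < 2 * (g : ℝ) / ((g : ℝ) - 2) := by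
  have hg' : (3 : ℝ) ≤ g := by exact_mod_cast hg
  rcases isEmpty_or_nonempty V with hV | hV
  · rw [mad_of_isEmpty]
    exact div_pos (by linarith) (by linarith)
  · obtain ⟨H, hH, mad_eq⟩ := (mad_isGreatest G).1
    have edges_le : (g : ℝ) * (H.edgeSet.ncard + 1) ≤
        2 * H.edgeSet.ncard + g * H.verts.ncard := by
      exact_mod_cast hG.mul_ncard_edgeSet_subgraph_le hgirth
        (Set.nonempty_of_ncard_ne_zero (Nat.one_le_iff_ne_zero.1 hH))
    have verts_pos : (0 : ℝ) < H.verts.ncard := by exact_mod_cast hH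
    rw [mad_eq, div_lt_div_iff₀ verts_pos (by linarith)]
    nlinarith
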